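/- Boolean functions on $n$ variables are maps $f:\mathbb{F}_2^n\to\mathbb{F}_2$; the models of $f$ are the $\mathbf{x}$ with $f(\mathbf{x})=1$, and all probabilities are with respect to the uniform distribution $\mathcal{U}$ on $\mathbb{F}_2^n$. A function $\tilde f$ is a weak $\varepsilon$-approximation of $f$ if $\Pr_{\mathbf{x}\sim\mathcal{U}}[f(\mathbf{x})\neq\tilde f(\mathbf{x})]\le\varepsilon$, and a strong $\varepsilon$-approximation of $f$ if $\Pr_{\mathbf{x}\sim\mathcal{U}}[f(\mathbf{x})\neq\tilde f(\mathbf{x})]\le\varepsilon\,\Pr_{\mathbf{x}\sim\mathcal{U}}[f(\mathbf{x})=1]$; $f$ is trivially weakly $\varepsilon$-approximable if the constant $0$-function is a weak $\varepsilon$-approximation of $f$. A d-DNNF over $n$ variables is a single-output circuit (a directed acyclic graph) whose input gates are variables and negated variables and whose internal gates are fan-in-2 AND- and OR-gates, such that the two subcircuits below any AND-gate share no variable and the two subcircuits below any OR-gate have no common model; its size is its number of gates. A matrix $H\in\mathbb{F}_2^{m\times n}$ is $s$-good if every submatrix formed by at least $n/3$ columns of $H$ has rank at least $s$. The characteristic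 function of the linear code with parity check matrix $H$ has as models exactly the $\mathbf{x}\in\mathbb{F}_2^n$ with $H\mathbf{x}=\mathbf{0}$. **Theorem.** For every $n$ let $m=\lfloor n/100\rfloor$, and let $\mathcal{C}_n$ be the set of characteristic functions of linear codes of length $n$ that have an $(m-1)$-good parity check matrix in $\mathbb{F}_2^{m\times n}$. Let $0\le\varepsilon<1$. Then there are $c>0$ and $n_0\in\mathbb{N}$ such that for all $n\ge n_0$ the set $\mathcal{C}_n$ is nonempty and every $f\in\mathcal{C}_n$ satisfies: 1. if $\varepsilon>0$, then $f$ is trivially weakly $\varepsilon$-approximable; 2. every d-DNNF over the $n$ variables that encodes a strong $\varepsilon$-approximation of $f$ has size at least $2^{cn}$. -/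

import Mathlib

/-- Assignments of `n` Boolean variables: vectors over the field with two elements. -/
abbrev Assignment (n : ℕ) : Type := Fin n → ZMod 2

/-- Boolean functions on `n` variables. The models of `f` are the `x` with `f x = 1`. -/
abbrev BoolFun (n : ℕ) : Type := Assignment n → ZMod 2

/-! ### Circuits in negation normal form -/

/-- The label of a gate which may use as inputs the `k` gates that precede it: a literal `x i` or
its negation, or a fan-in 2 AND or OR of two earlier gates. -/
inductive NNFGate (n k : ℕ) : Type
  | pos (i : Fin n)
  | neg (i : Fin n)
  | and (l r : Fin k)
  | or (l r : Fin k)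

/-- A circuit in negation normal form over `n` variables: a directed acyclic graph of gates, listed
in a topological order, with one output gate. A gate may be used as input by any number of later
gates. The size is the number of all gates, input gates included. -/
structure NNF (n : ℕ) : Type where
  size : ℕ
  gate : (g : Fin size) → NNFGate n g.val
  output : Fin size

namespace NNF

variable {n : ℕ} (C : NNF n)

/-- An input of the gate `g`, as a gate of the circuit. -/
def child (g : Fin C.size) (j : Fin g.val) : Fin C.size :=
  ⟨j.val, j.isLt.trans g.isLt⟩

theorem child_lt (g : Fin C.size) (j : Fin g.val) : (C.child g j).val < g.val := j.isLt

/-- The Boolean function computed at the gate `g`. In the field with two elements, `¬ a` is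
`1 + a`, `a ∧ b` is `a * b` and `a ∨ b` is `a + b + a * b`. -/
def evalAt (g : Fin C.size) (x : Assignment n) : ZMod 2 :=
  match C.gate g with
  | .pos i => x i
  | .neg i => 1 + x i
  | .and l r => evalAt (C.child g l) x * evalAt (C.child g r) x
  | .or l r => evalAt (C.child g l) x + evalAt (C.child g r) x +
      evalAt (C.child g l) x * evalAt (C.child g r) x
termination_by g.val
decreasing_by all_goals exact C.child_lt g _

/-- The variables labelling (positively or negatively) the input gates of the subcircuit rooted at
the gate `g`. -/
def varsAt (g : Fin C.size) : Finset (Fin n) :=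
  match C.gate g with
  | .pos i => {i}
  | .neg i => {i}
  | .and l r => varsAt (C.child g l) ∪ varsAt (C.child g r)
  | .or l r => varsAt (C.child g l) ∪ varsAt (C.child g r)
termination_by g.val
decreasing_by all_goals exact C.child_lt g _

/-- The Boolean function that the circuit encodes. -/
def eval : BoolFun n := C.evalAt C.output

/-- The two subcircuits below any AND-gate share no variable. -/
def Decomposable : Prop :=
  ∀ (g : Fin C.size) (l r : Fin g.val), C.gate g = .and l r →
    Disjoint (C.varsAt (C.child g l)) (C.varsAt (C.child g r))

/-- The two subcircuits below any OR-gate have no common model. -/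
def Deterministic : Prop :=
  ∀ (g : Fin C.size) (l r : Fin g.val), C.gate g = .or l r →
    ∀ x : Assignment n, ¬ (C.evalAt (C.child g l) x = 1 ∧ C.evalAt (C.child g r) x = 1)

/-- d-DNNF: deterministic decomposable negation normal form. -/
def IsDDNNF : Prop := C.Decomposable ∧ C.Deterministic

end NNF

/-! ### Weak and strong approximation -/

/-- The probability of the event `S` when sampling an assignment according to `D`. -/
noncomputable def prob {n : ℕ} (D : PMF (Assignment n)) (S : Set (Assignment n)) : ℝ :=
  (D.toOuterMeasure S).toReal

/-- The uniform distribution on assignments. -/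
noncomputable def unif (n : ℕ) : PMF (Assignment n) := PMF.uniformOfFintype (Assignment n)

/-- `f'` is a weak `ε`-approximation of `f` with respect to `D`. -/
def IsWeakApprox {n : ℕ} (D : PMF (Assignment n)) (ε : ℝ) (f f' : BoolFun n) : Prop :=
  prob D {x | f x ≠ f' x} ≤ ε

/-- `f'` is a strong `ε`-approximation of `f` with respect to `D`. -/
def IsStrongApprox {n : ℕ} (D : PMF (Assignment n)) (ε : ℝ) (f f' : BoolFun n) : Prop :=
  prob D {x | f x ≠ f' x} ≤ ε * prob D {x | f x = 1}

/-- The constant `0`-function is a weak `ε`-approximation of `f`. -/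
def IsTriviallyWeaklyApproximable {n : ℕ} (D : PMF (Assignment n)) (ε : ℝ) (f : BoolFun n) :
    Prop :=
  IsWeakApprox D ε f (fun _ => 0)

/-! ### Linear codes with good parity check matrices -/

/-- `H` is `s`-good: every submatrix formed by at least `n / 3` columns of `H` has rank at
least `s`. -/
def IsGood {m n : ℕ} (s : ℕ) (H : Matrix (Fin m) (Fin n) (ZMod 2)) : Prop :=
  ∀ I : Finset (Fin n), n ≤ 3 * I.card →
    s ≤ (H.submatrix id (fun i : I => (i : Fin n))).rank

/-- The characteristic function of the linear code with parity check matrix `H`. -/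
def codeFun {m n : ℕ} (H : Matrix (Fin m) (Fin n) (ZMod 2)) : BoolFun n :=
  fun x => if H.mulVec x = 0 then 1 else 0

/-- The characteristic functions of the linear codes of length `n` that have an `(m - 1)`-good
parity check matrix with `m = ⌊n / 100⌋` rows. -/
def goodCodeClass (n : ℕ) : Set (BoolFun n) :=
  {f | ∃ H : Matrix (Fin (n / 100)) (Fin n) (ZMod 2), IsGood (n / 100 - 1) H ∧ f = codeFun H}

/-! A code with an s-good parity check matrix, s = m - 1, has density at most 2^(-s), so the zero
function approximates it weakly. Strong approximation is hard because the code meets every balanced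
rectangle in few points. For blocks X and Xᶜ of at least n/3 variables each, the codewords in A × B
are pairs with H₁u = -H₂v. Both halves of H have rank at least s, so each u matches at most
2^(|Xᶜ|-s) vectors v, and each v at most 2^(|X|-s) vectors u. Multiplying the two bounds, a
rectangle R has at most (2^(n-2s) |R|)^(1/2) codewords (`sq_sum_codewords_le`).

A d-DNNF of size N is a disjoint sum of at most N² balanced rectangles
(`exists_balanced_rectangles`). By Cauchy–Schwarz P² ≤ N² 2^(n-2s) T, where P counts the accepted
codewords and T all accepted inputs. With F ≥ 2^(n-m) codewords, a strong approximation has P ≥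
(1-ε)F and T ≤ 2F, whence N² ≥ (1-ε)² 2^m / 8.

Good matrices exist by an exponential moment and a union bound (`exists_isGood`). -/

namespace NNF

variable {n : ℕ} {C : NNF n}

/-! ### Values and variables of gates. -/

theorem evalAt_pos {g : Fin C.size} {i : Fin n} (h : C.gate g = .pos i) (x : Assignment n) :
    C.evalAt g x = x i := by
  rw [evalAt]; split <;> simp_all

theorem evalAt_neg {g : Fin C.size} {i : Fin n} (h : C.gate g = .neg i) (x : Assignment n) :
    C.evalAt g x = 1 + x i := by
  rw [evalAt]; split <;> simp_all

theorem evalAt_and {g : Fin C.size} {l r : Fin g.val} (h : C.gate g = .and l r)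
    (x : Assignment n) :
    C.evalAt g x = C.evalAt (C.child g l) x * C.evalAt (C.child g r) x := by
  rw [evalAt]; split <;> simp_all

theorem evalAt_or {g : Fin C.size} {l r : Fin g.val} (h : C.gate g = .or l r)
    (x : Assignment n) :
    C.evalAt g x = C.evalAt (C.child g l) x + C.evalAt (C.child g r) x +
      C.evalAt (C.child g l) x * C.evalAt (C.child g r) x := by
  rw [evalAt]; split <;> simp_all

theorem varsAt_pos {g : Fin C.size} {i : Fin n} (h : C.gate g = .pos i) :
    C.varsAt g = {i} := by
  rw [varsAt]; split <;> simp_all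

theorem varsAt_neg {g : Fin C.size} {i : Fin n} (h : C.gate g = .neg i) :
    C.varsAt g = {i} := by
  rw [varsAt]; split <;> simp_all

theorem varsAt_and {g : Fin C.size} {l r : Fin g.val} (h : C.gate g = .and l r) :
    C.varsAt g = C.varsAt (C.child g l) ∪ C.varsAt (C.child g r) := by
  rw [varsAt]; split <;> simp_all

theorem varsAt_or {g : Fin C.size} {l r : Fin g.val} (h : C.gate g = .or l r) :
    C.varsAt g = C.varsAt (C.child g l) ∪ C.varsAt (C.child g r) := by
  rw [varsAt]; split <;> simp_all

variable (C) in
theorem gate_induction {P : Fin C.size → Prop}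
    (step : ∀ g, (∀ j : Fin g.val, P (C.child g j)) → P g) (g : Fin C.size) : P g := by
  obtain ⟨k, hk⟩ := g
  induction k using Nat.strong_induction_on with
  | _ k ih => exact step ⟨k, hk⟩ fun j => ih j.val j.isLt _

variable (C) in
/-- The value at a gate as a natural number, `0` or `1`. -/
def natEvalAt (g : Fin C.size) (x : Assignment n) : ℕ := (C.evalAt g x).val

theorem dependsOn_evalAt (g : Fin C.size) : DependsOn (C.evalAt g) (C.varsAt g) := by
  induction g using C.gate_induction with
  | step g ih =>
    intro x y hxy
    cases h : C.gate g with
    | pos i => rw [evalAt_pos h, evalAt_pos h]; exact hxy i (by simp [varsAt_pos h])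
    | neg i => rw [evalAt_neg h, evalAt_neg h, hxy i (by simp [varsAt_neg h])]
    | and l r =>
      rw [varsAt_and h] at hxy
      rw [evalAt_and h, evalAt_and h, ih l fun i hi => hxy i (by simp_all),
        ih r fun i hi => hxy i (by simp_all)]
    | or l r =>
      rw [varsAt_or h] at hxy
      rw [evalAt_or h, evalAt_or h, ih l fun i hi => hxy i (by simp_all),
        ih r fun i hi => hxy i (by simp_all)]

theorem dependsOn_natEvalAt (g : Fin C.size) : DependsOn (C.natEvalAt g) (C.varsAt g) :=
  fun _ _ hxy => congrArg ZMod.val (dependsOn_evalAt g hxy)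

theorem natEvalAt_and {g : Fin C.size} {l r : Fin g.val} (h : C.gate g = .and l r)
    (x : Assignment n) :
    C.natEvalAt g x = C.natEvalAt (C.child g l) x * C.natEvalAt (C.child g r) x := by
  have key : ∀ a b : ZMod 2, (a * b).val = a.val * b.val := by decide
  simp only [natEvalAt, evalAt_and h, key]

/-- Determinism turns OR into addition in ℕ, so models are counted without overlap. -/
theorem natEvalAt_or (hC : C.Deterministic) {g : Fin C.size} {l r : Fin g.val}
    (h : C.gate g = .or l r) (x : Assignment n) :
    C.natEvalAt g x = C.natEvalAt (C.child g l) x + C.natEvalAt (C.child g r) x := by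
  have key : ∀ a b : ZMod 2, ¬ (a = 1 ∧ b = 1) → (a + b + a * b).val = a.val + b.val := by decide
  simp only [natEvalAt, evalAt_or h, key _ _ (hC g l r h x)]

end NNF

/-! ### Balanced partitions and the rectangle decomposition of a d-DNNF. -/

/-- Both blocks of the partition `(X, Xᶜ)` of the `n` variables have at least `n / 3` elements. -/
def IsBalanced {n : ℕ} (X : Finset (Fin n)) : Prop := n ≤ 3 * X.card ∧ n ≤ 3 * Xᶜ.card

/-- A set that is too small is padded inside `T`. The last clause forbids padding when none is
needed, which AND-gates rely on. -/
theorem exists_isBalanced_between {n : ℕ} (hn : 2 ≤ n) {S T : Finset (Fin n)} (hST : S ⊆ T)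
    (hS : 3 * S.card ≤ 2 * n) (hT : 2 * n < 3 * T.card) :
    ∃ X, S ⊆ X ∧ X ⊆ T ∧ IsBalanced X ∧ (n ≤ 3 * S.card → X = S) := by
  have bal : ∀ X : Finset (Fin n), n ≤ 3 * X.card → 3 * X.card ≤ 2 * n → IsBalanced X := by
    intro X h₁ h₂
    refine ⟨h₁, ?_⟩
    rw [Finset.card_compl, Fintype.card_fin]
    omega
  by_cases h : n ≤ 3 * S.card
  · exact ⟨S, subset_rfl, hST, bal S h hS, fun _ => rfl⟩
  -- This size is n/3 rounded up; it is at most 2n/3 because n ≥ 2.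
  · obtain ⟨X, hSX, hXT, hX⟩ := Finset.exists_subsuperset_card_eq hST
      (n := (n + 2) / 3) (by omega) (by omega)
    exact ⟨X, hSX, hXT, bal X (by omega) (by omega), fun h' => absurd h' h⟩

namespace NNF

variable {n : ℕ} {C : NNF n}

open Classical in
variable (C) in
/-- A balanced set of variables between those of the gates `c` and `g`, where `i = (g, c)`. -/
noncomputable def cut (i : Fin C.size × Fin C.size) : Finset (Fin n) :=
  if h : ∃ X, C.varsAt i.2 ⊆ X ∧ X ⊆ C.varsAt i.1 ∧ IsBalanced X ∧
    (n ≤ 3 * (C.varsAt i.2).card → X = C.varsAt i.2) then h.choose else ∅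

theorem cut_spec (hn : 2 ≤ n) {g c : Fin C.size} (hsub : C.varsAt c ⊆ C.varsAt g)
    (hc : 3 * (C.varsAt c).card ≤ 2 * n) (hg : 2 * n < 3 * (C.varsAt g).card) :
    C.varsAt c ⊆ C.cut (g, c) ∧ C.cut (g, c) ⊆ C.varsAt g ∧ IsBalanced (C.cut (g, c)) ∧
      (n ≤ 3 * (C.varsAt c).card → C.cut (g, c) = C.varsAt c) := by
  have h := exists_isBalanced_between hn hsub hc hg
  unfold cut
  rw [dif_pos h]
  exact h.choose_spec

variable (C) in
/-- A decomposition of the function `f` into rectangles over balanced partitions: the factors on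
the first blocks are the functions computed at gates, those on the second blocks are `b`. All
first blocks consist of variables in `V`. -/
structure RectSum (V : Finset (Fin n)) (f : Assignment n → ℕ)
    (b : Fin C.size × Fin C.size → Assignment n → ℕ) : Prop where
  sum_eq : ∀ x, ∑ i, C.natEvalAt i.2 x * b i x = f x
  balanced : ∀ i, b i ≠ 0 → IsBalanced (C.cut i)
  cut_subset : ∀ i, b i ≠ 0 → C.cut i ⊆ V
  vars_subset : ∀ i, b i ≠ 0 → C.varsAt i.2 ⊆ C.cut i
  dependsOn : ∀ i, DependsOn (b i) ((C.cut i)ᶜ : Finset (Fin n))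

theorem RectSum.mono {V W : Finset (Fin n)} {f b} (h : C.RectSum V f b) (hVW : V ⊆ W) :
    C.RectSum W f b :=
  ⟨h.sum_eq, h.balanced, fun i hi => (h.cut_subset i hi).trans hVW, h.vars_subset, h.dependsOn⟩

theorem RectSum.of_eq {V : Finset (Fin n)} {f f' b} (h : C.RectSum V f b)
    (hf : ∀ x, f' x = f x) : C.RectSum V f' b :=
  (funext hf : f' = f) ▸ h

/-- The first factor and the cut depend only on the index, so terms with the same index merge by
adding their second factors. This keeps the count at N² instead of growing with the number of paths.
-/
theorem RectSum.add {V : Finset (Fin n)} {f₁ f₂ b₁ b₂} (h₁ : C.RectSum V f₁ b₁)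
    (h₂ : C.RectSum V f₂ b₂) : C.RectSum V (f₁ + f₂) (b₁ + b₂) := by
  have key : ∀ {P : Fin C.size × Fin C.size → Prop}, (∀ i, b₁ i ≠ 0 → P i) →
      (∀ i, b₂ i ≠ 0 → P i) → ∀ i, (b₁ + b₂) i ≠ 0 → P i := by
    intro P hP₁ hP₂ i hi
    by_cases h : b₁ i = 0
    · refine hP₂ i fun h' => hi ?_
      rw [Pi.add_apply, h, h', add_zero]
    · exact hP₁ i h
  refine ⟨fun x => ?_, key h₁.balanced h₂.balanced, key h₁.cut_subset h₂.cut_subset,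
    key h₁.vars_subset h₂.vars_subset, fun i x y hxy => ?_⟩
  · simp only [Pi.add_apply, mul_add, Finset.sum_add_distrib, h₁.sum_eq, h₂.sum_eq]
  · simp only [Pi.add_apply, h₁.dependsOn i hxy, h₂.dependsOn i hxy]

/-- All cuts lie in `V`, so a function of variables outside `V` can be absorbed into the second
factors. -/
theorem RectSum.mul {V W : Finset (Fin n)} {f b} (h : C.RectSum V f b) {k : Assignment n → ℕ}
    (hk : DependsOn k W) (hVW : Disjoint V W) : C.RectSum V (f * k) (fun i => b i * k) := by
  have key : ∀ {P : Fin C.size × Fin C.size → Prop}, (∀ i, b i ≠ 0 → P i) →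
      ∀ i, b i * k ≠ 0 → P i := fun hP i hi => hP i fun h' => hi (by rw [h', zero_mul])
  refine ⟨fun x => ?_, key h.balanced, key h.cut_subset, key h.vars_subset,
    fun i x y hxy => ?_⟩
  · simp only [Pi.mul_apply, ← mul_assoc, ← Finset.sum_mul, h.sum_eq]
  · by_cases hi : b i = 0
    · simp [hi]
    · rw [Pi.mul_apply, Pi.mul_apply, h.dependsOn i hxy]
      congr 1
      refine hk fun j hj => hxy j ?_
      simp only [Finset.coe_compl, Set.mem_compl_iff, Finset.mem_coe]
      exact fun hj' => Finset.disjoint_left.mp hVW (h.cut_subset i hi hj') hj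

/-- The decomposition below a wire from `c` to a gate `g` with many variables. -/
theorem exists_rectSum_wire (hn : 2 ≤ n) {g c : Fin C.size} (hsub : C.varsAt c ⊆ C.varsAt g)
    (hg : 2 * n < 3 * (C.varsAt g).card)
    (ih : 2 * n < 3 * (C.varsAt c).card → ∃ b, C.RectSum (C.varsAt c) (C.natEvalAt c) b) :
    ∃ b, C.RectSum (if n ≤ 3 * (C.varsAt c).card then C.varsAt c else C.varsAt g)
      (C.natEvalAt c) b := by
  by_cases hc : 2 * n < 3 * (C.varsAt c).card
  · obtain ⟨b, hb⟩ := ih hc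
    rw [if_pos (by omega)]
    exact ⟨b, hb⟩
  -- The recursion stops here: `c` has at most 2n/3 variables, so its function is a single rectangle
  -- with second factor 1, indexed by the wire.
  · obtain ⟨h₁, h₂, h₃, h₄⟩ := cut_spec hn hsub (by omega) hg
    have key : ∀ {P : Fin C.size × Fin C.size → Prop}, P (g, c) →
        ∀ i, (if i = (g, c) then 1 else 0 : Assignment n → ℕ) ≠ 0 → P i := by
      intro P hP i hi
      by_cases h : i = (g, c)
      · rwa [h]
      · simp [h] at hi
    refine ⟨fun i => if i = (g, c) then 1 else 0, fun x => ?_, key h₃, key ?_, key h₁,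
      fun i x y _ => ?_⟩
    · rw [Finset.sum_eq_single (g, c)] <;> simp +contextual
    · split_ifs with h
      · rw [h₄ h]
      · exact h₂
    · split_ifs <;> rfl

theorem exists_rectSum (hn : 2 ≤ n) (hC : C.IsDDNNF) (g : Fin C.size) :
    2 * n < 3 * (C.varsAt g).card → ∃ b, C.RectSum (C.varsAt g) (C.natEvalAt g) b := by
  induction g using C.gate_induction with
  | step g ih =>
    intro hg
    cases h : C.gate g with
    | pos i => rw [varsAt_pos h, Finset.card_singleton] at hg; omega
    | neg i => rw [varsAt_neg h, Finset.card_singleton] at hg; omega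
    | and l r =>
      have hv := varsAt_and h
      have hl : C.varsAt (C.child g l) ⊆ C.varsAt g := hv ▸ Finset.subset_union_left
      have hr : C.varsAt (C.child g r) ⊆ C.varsAt g := hv ▸ Finset.subset_union_right
      have hdis := hC.1 g l r h
      have hcard : (C.varsAt g).card =
          (C.varsAt (C.child g l)).card + (C.varsAt (C.child g r)).card := by
        rw [hv, Finset.card_union_of_disjoint hdis]
      -- The disjoint variable sets of the inputs together exceed 2n/3, so one has at least n/3.
      -- Decomposing that input keeps all cuts within its own variables, and the other input becomes
      -- an outside factor.
      by_cases hlr : n ≤ 3 * (C.varsAt (C.child g l)).card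
      · obtain ⟨b, hb⟩ := exists_rectSum_wire hn hl hg (ih l)
        rw [if_pos hlr] at hb
        exact ⟨_, ((hb.mul (dependsOn_natEvalAt (C.child g r)) hdis).mono hl).of_eq
          fun x => natEvalAt_and h x⟩
      · obtain ⟨b, hb⟩ := exists_rectSum_wire hn hr hg (ih r)
        rw [if_pos (by omega)] at hb
        exact ⟨_, ((hb.mul (dependsOn_natEvalAt (C.child g l)) hdis.symm).mono hr).of_eq
          fun x => (natEvalAt_and h x).trans (mul_comm _ _)⟩
    | or l r =>
      have hv := varsAt_or h
      have hl : C.varsAt (C.child g l) ⊆ C.varsAt g := hv ▸ Finset.subset_union_left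
      have hr : C.varsAt (C.child g r) ⊆ C.varsAt g := hv ▸ Finset.subset_union_right
      obtain ⟨b₁, hb₁⟩ := exists_rectSum_wire hn hl hg (ih l)
      obtain ⟨b₂, hb₂⟩ := exists_rectSum_wire hn hr hg (ih r)
      refine ⟨_, ((hb₁.mono ?_).add (hb₂.mono ?_)).of_eq fun x => natEvalAt_or hC.2 h x⟩
      · split_ifs
        exacts [hl, subset_rfl]
      · split_ifs
        exacts [hr, subset_rfl]

/-- A d-DNNF of size `s` is a sum of at most `s ^ 2` rectangles over balanced partitions. -/
theorem exists_balanced_rectangles (hn : 2 ≤ n) (hC : C.IsDDNNF) :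
    ∃ (X : Fin C.size × Fin C.size → Finset (Fin n))
      (a b : Fin C.size × Fin C.size → Assignment n → ℕ),
      (∀ i, IsBalanced (X i)) ∧ (∀ i, DependsOn (a i) (X i)) ∧
      (∀ i, DependsOn (b i) ((X i)ᶜ : Finset (Fin n))) ∧
      ∀ x, ∑ i, a i x * b i x = (C.eval x).val := by
  classical
  have hT : 2 * n < 3 * (Finset.univ : Finset (Fin n)).card := by
    rw [Finset.card_univ, Fintype.card_fin]; omega
  by_cases hg : 2 * n < 3 * (C.varsAt C.output).card
  · obtain ⟨b, hb⟩ := exists_rectSum hn hC C.output hg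
    obtain ⟨X₀, -, -, hX₀, -⟩ := exists_isBalanced_between hn (Finset.empty_subset _) (by simp) hT
    -- Cuts are controlled only where `b i ≠ 0`; the remaining terms become zero rectangles over an
    -- arbitrary balanced set.
    refine ⟨fun i => if b i = 0 then X₀ else C.cut i,
      fun i => if b i = 0 then 0 else C.natEvalAt i.2, b, fun i => ?_, fun i => ?_, fun i => ?_,
      fun x => ?_⟩
    · dsimp only
      split_ifs with h
      exacts [hX₀, hb.balanced i h]
    · dsimp only
      split_ifs with h
      · exact fun _ _ _ => rfl
      · exact (dependsOn_natEvalAt i.2).mono (by exact_mod_cast hb.vars_subset i h)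
    · dsimp only
      split_ifs with h
      · rw [h]; exact fun _ _ _ => rfl
      · exact hb.dependsOn i
    · refine Eq.trans (Finset.sum_congr rfl fun i _ => ?_) (hb.sum_eq x)
      dsimp only
      split_ifs with h
      · simp [h]
      · rfl
  -- With so few variables the whole function is one rectangle.
  · obtain ⟨X₀, hsub, -, hX₀, -⟩ := exists_isBalanced_between hn
      (Finset.subset_univ (C.varsAt C.output)) (by omega) hT
    refine ⟨fun _ => X₀, fun _ => C.natEvalAt C.output,
      fun i _ => if i = (C.output, C.output) then 1 else 0, fun _ => hX₀,
      fun _ => (dependsOn_natEvalAt _).mono (by exact_mod_cast hsub), fun _ _ _ _ => rfl,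
      fun x => ?_⟩
    simp [natEvalAt, eval]

end NNF

/-! ### Codewords inside a balanced rectangle. -/

theorem card_ker_mul_two_pow_rank {κ ι : Type*} [Fintype κ] [Fintype ι] [DecidableEq ι]
    [DecidableEq κ] (A : Matrix κ ι (ZMod 2)) :
    (Finset.univ.filter fun x => A.mulVec x = 0).card * 2 ^ A.rank = 2 ^ Fintype.card ι := by
  have h₁ := LinearMap.finrank_range_add_finrank_ker A.mulVecLin
  have h₂ : Nat.card (LinearMap.ker A.mulVecLin) =
      Fintype.card (ZMod 2) ^ Module.finrank (ZMod 2) (LinearMap.ker A.mulVecLin) := by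
    have := Fintype.ofFinite (LinearMap.ker A.mulVecLin)
    rw [Nat.card_eq_fintype_card, Module.card_eq_pow_finrank (K := ZMod 2)]
  have h₃ : (Finset.univ.filter fun x => A.mulVec x = 0).card =
      Nat.card (LinearMap.ker A.mulVecLin) := 
    (Nat.subtype_card _ (by simp [LinearMap.mem_ker])).symm
  rw [h₃, h₂, ZMod.card, ← pow_add, Matrix.rank, add_comm, h₁,
    Module.finrank_fintype_fun_eq_card]

/-- A nonempty fiber is a translate of the kernel. -/
theorem card_fiber_mul_two_pow_rank_le {κ ι : Type*} [Fintype κ] [Fintype ι] [DecidableEq ι]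
    [DecidableEq κ] (A : Matrix κ ι (ZMod 2)) (v : κ → ZMod 2) :
    (Finset.univ.filter fun x => A.mulVec x = v).card * 2 ^ A.rank ≤ 2 ^ Fintype.card ι := by
  rw [← card_ker_mul_two_pow_rank A]
  refine Nat.mul_le_mul_right _ ?_
  rcases (Finset.univ.filter fun x => A.mulVec x = v).eq_empty_or_nonempty with h | ⟨x₀, h₀⟩
  · simp [h]
  · rw [Finset.mem_filter] at h₀
    refine Finset.card_le_card_of_injOn (fun x => x - x₀) (fun x hx => ?_)
      (sub_left_injective.injOn)
    simp_all [Matrix.mulVec_sub]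

theorem sum_matching_mul_le {U V W : Type*} [Fintype U] [Fintype V] [DecidableEq W]
    (φ : U → W) (ψ : V → W) (a : U → ℕ) (b : V → ℕ) (hb : ∀ v, b v ≤ 1) {k K : ℕ}
    (hψ : ∀ w, (Finset.univ.filter fun v => ψ v = w).card * k ≤ K) :
    (∑ u, ∑ v, if φ u = ψ v then a u * b v else 0) * k ≤ K * ∑ u, a u := by
  rw [Finset.sum_mul, Finset.mul_sum]
  refine Finset.sum_le_sum fun u _ => ?_
  calc (∑ v, if φ u = ψ v then a u * b v else 0) * k
      ≤ (∑ v, if ψ v = φ u then a u else 0) * k := by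
        refine Nat.mul_le_mul_right _ (Finset.sum_le_sum fun v _ => ?_)
        simp only [eq_comm (a := φ u)]
        split_ifs
        · exact (Nat.mul_le_mul_left _ (hb v)).trans_eq (mul_one _)
        · exact le_rfl
    _ = a u * ((Finset.univ.filter fun v => ψ v = φ u).card * k) := by
        rw [← Finset.sum_filter, Finset.sum_const, smul_eq_mul]; ring
    _ ≤ K * a u := by
        rw [mul_comm K]; exact Nat.mul_le_mul_left _ (hψ _)

/-- Matching pairs are bounded once through fibers of `ψ` and once through fibers of `φ`; the
product of the bounds contains (∑ a)(∑ b), the size of the rectangle. -/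
theorem sq_sum_matching_le {U V W : Type*} [Fintype U] [Fintype V] [DecidableEq W]
    (φ : U → W) (ψ : V → W) (a : U → ℕ) (b : V → ℕ) (hab : ∀ u v, a u * b v ≤ 1) {k K L : ℕ}
    (hφ : ∀ w, (Finset.univ.filter fun u => φ u = w).card * k ≤ K)
    (hψ : ∀ w, (Finset.univ.filter fun v => ψ v = w).card * k ≤ L) :
    (∑ u, ∑ v, if φ u = ψ v then a u * b v else 0) ^ 2 * k ^ 2 ≤
      K * L * ∑ u, ∑ v, a u * b v := by
  by_cases ha : ∀ u, a u = 0
  · simp [ha]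
  by_cases hb : ∀ v, b v = 0
  · simp [hb]
  push Not at ha hb
  obtain ⟨u₀, hu⟩ := ha
  obtain ⟨v₀, hv⟩ := hb
  have hb : ∀ v, b v ≤ 1 := fun v =>
    (Nat.le_mul_of_pos_left _ (Nat.pos_of_ne_zero hu)).trans (hab u₀ v)
  have ha : ∀ u, a u ≤ 1 := fun u =>
    (Nat.le_mul_of_pos_right _ (Nat.pos_of_ne_zero hv)).trans (hab u v₀)
  have h₁ := sum_matching_mul_le φ ψ a b hb hψ
  have h₂ := sum_matching_mul_le ψ φ b a ha hφ
  have h₃ : (∑ v, ∑ u, if ψ v = φ u then b v * a u else 0) =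
      ∑ u, ∑ v, if φ u = ψ v then a u * b v else 0 := by
    rw [Finset.sum_comm]
    simp only [eq_comm, mul_comm]
  rw [h₃] at h₂
  have h₄ : ∑ u, ∑ v, a u * b v = (∑ u, a u) * ∑ v, b v := by
    rw [Finset.sum_mul_sum]
  rw [h₄]
  calc _ = ((∑ u, ∑ v, if φ u = ψ v then a u * b v else 0) * k) *
        ((∑ u, ∑ v, if φ u = ψ v then a u * b v else 0) * k) := by ring
    _ ≤ _ := Nat.mul_le_mul h₁ h₂
    _ = _ := by ring

theorem sq_sum_codewords_le {m n s : ℕ} (H : Matrix (Fin m) (Fin n) (ZMod 2)) (hH : IsGood s H)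
    {X : Finset (Fin n)} (hX : IsBalanced X) {a b : Assignment n → ℕ}
    (ha : DependsOn a X) (hb : DependsOn b (Xᶜ : Finset (Fin n)))
    (hab : ∀ x, a x * b x ≤ 1) :
    (∑ x, if H.mulVec x = 0 then a x * b x else 0) ^ 2 * (2 ^ s) ^ 2 ≤
      2 ^ n * ∑ x, a x * b x := by
  let e := Equiv.piEquivPiSubtypeProd (fun i => i ∈ X) (fun _ : Fin n => ZMod 2)
  let H₁ : Matrix (Fin m) {i // i ∈ X} (ZMod 2) := H.submatrix id (fun i => i.1)
  let H₂ : Matrix (Fin m) {i // ¬ i ∈ X} (ZMod 2) := H.submatrix id (fun i => i.1)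
  have hr₁ : s ≤ H₁.rank := hH X hX.1
  have hr₂ : s ≤ H₂.rank := by
    refine (hH Xᶜ hX.2).trans_eq ?_
    let e' : {i // i ∈ Xᶜ} ≃ {i // ¬ i ∈ X} := Equiv.subtypeEquivRight fun i => by simp
    exact Matrix.rank_submatrix H₂ (Equiv.refl _) e'
  have hmul : ∀ p, H.mulVec (e.symm p) = 0 ↔ H₁.mulVec p.1 = -(H₂.mulVec p.2) := by
    intro p
    rw [← add_eq_zero_iff_eq_neg]
    have : H.mulVec (e.symm p) = H₁.mulVec p.1 + H₂.mulVec p.2 := by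
      funext j
      simp only [Matrix.mulVec, dotProduct, Pi.add_apply]
      rw [← Fintype.sum_subtype_add_sum_subtype (fun i => i ∈ X)]
      congr 1
      · refine Finset.sum_congr (by ext; simp) fun i _ => ?_
        simp [e, H₁, Equiv.piEquivPiSubtypeProd, i.2]
      · refine Finset.sum_congr (by ext; simp) fun i _ => ?_
        simp [e, H₂, Equiv.piEquivPiSubtypeProd, i.2]
    rw [this]
  have ha' : ∀ u v v', a (e.symm (u, v)) = a (e.symm (u, v')) := by
    refine fun u v v' => ha fun i hi => ?_
    have : i ∈ X := hi
    simp [e, Equiv.piEquivPiSubtypeProd, this]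
  have hb' : ∀ u u' v, b (e.symm (u, v)) = b (e.symm (u', v)) := by
    refine fun u u' v => hb fun i hi => ?_
    have : ¬ i ∈ X := by simpa using hi
    simp [e, Equiv.piEquivPiSubtypeProd, this]
  have hpow : ∀ {c r K : ℕ}, s ≤ r → c * 2 ^ r ≤ K → c * 2 ^ s ≤ K := fun h h' =>
    (Nat.mul_le_mul_left _ (Nat.pow_le_pow_right two_pos h)).trans h'
  have key := sq_sum_matching_le (fun u => H₁.mulVec u) (fun v => -(H₂.mulVec v))
    -- The filler 0 is harmless, since each factor ignores the other block.
    (fun u => a (e.symm (u, 0))) (fun v => b (e.symm (0, v)))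
    (fun u v => by
      rw [ha' u 0 v, hb' 0 u v]; exact hab _)
    (fun w => hpow hr₁ (card_fiber_mul_two_pow_rank_le H₁ w))
    (fun w => by
      simp only [neg_eq_iff_eq_neg]
      exact hpow hr₂ (card_fiber_mul_two_pow_rank_le H₂ (-w)))
  have hcard : Fintype.card {i // i ∈ X} + Fintype.card {i // ¬ i ∈ X} = n := by
    rw [← Fintype.card_sum, Fintype.card_congr (Equiv.sumCompl fun i => i ∈ X), Fintype.card_fin]
  rw [← pow_add, hcard] at key
  have e₁ : (∑ x, if H.mulVec x = 0 then a x * b x else 0) =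
      ∑ u, ∑ v, if H₁.mulVec u = -(H₂.mulVec v) then
        a (e.symm (u, 0)) * b (e.symm (0, v)) else 0 := by
    rw [← e.symm.sum_comp, Fintype.sum_prod_type]
    refine Finset.sum_congr rfl fun u _ => Finset.sum_congr rfl fun v _ => ?_
    simp only [hmul]
    rw [ha' u 0 v, hb' 0 u v]
  have e₂ : ∑ x, a x * b x = ∑ u, ∑ v, a (e.symm (u, 0)) * b (e.symm (0, v)) := by
    rw [← e.symm.sum_comp, Fintype.sum_prod_type]
    refine Finset.sum_congr rfl fun u _ => Finset.sum_congr rfl fun v _ => ?_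
    rw [ha' u 0 v, hb' 0 u v]
  rw [e₁, e₂]
  exact key

/-! ### Existence of good parity check matrices. -/

/-- Rank below m - 1 leaves two independent row relations. Together they kill a random column with
probability 1/4, less than the density 1/3 of the chosen columns; one relation would kill half of
them. -/
theorem exists_left_annihilator {m : ℕ} {ι : Type*} [Fintype ι]
    (A : Matrix (Fin m) ι (ZMod 2)) (hA : A.rank < m - 1) :
    ∃ M : Matrix (Fin 2) (Fin m) (ZMod 2), M.rank = 2 ∧ M * A = 0 := by
  have h₁ := LinearMap.finrank_range_add_finrank_ker A.transpose.mulVecLin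
  rw [Module.finrank_fintype_fun_eq_card, Fintype.card_fin] at h₁
  have h₂ : Module.finrank (ZMod 2) (LinearMap.range A.transpose.mulVecLin) = A.rank :=
    A.rank_transpose
  have h₃ : 1 < Module.finrank (ZMod 2) (LinearMap.ker A.transpose.mulVecLin) := by omega
  have := Module.nontrivial_of_finrank_pos (zero_lt_one.trans h₃)
  obtain ⟨x, hx⟩ := exists_ne (0 : LinearMap.ker A.transpose.mulVecLin)
  obtain ⟨y, hxy⟩ := exists_linearIndependent_pair_of_one_lt_finrank h₃ hx
  have hind := hxy.map' (Submodule.subtype _) (Submodule.ker_subtype _)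
  refine ⟨Matrix.of fun i => (![x, y] i : Fin m → ZMod 2), ?_, ?_⟩
  · exact (LinearIndependent.rank_matrix hind).trans (Fintype.card_fin 2)
  · have key : ∀ z : LinearMap.ker A.transpose.mulVecLin, Matrix.vecMul z.1 A = 0 := by
      intro z
      rw [← Matrix.mulVec_transpose]
      exact z.2
    ext i j
    exact congrFun (key (![x, y] i)) j

/-- The weight `3` of the vectors killed by `M`, and `2` of the others. -/
def kernelWeight {m : ℕ} (M : Matrix (Fin 2) (Fin m) (ZMod 2)) (h : Fin m → ZMod 2) : ℕ :=
  if M.mulVec h = 0 then 3 else 2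

theorem four_mul_sum_kernelWeight {m : ℕ} {M : Matrix (Fin 2) (Fin m) (ZMod 2)}
    (hM : M.rank = 2) : 4 * ∑ h, kernelWeight M h = 9 * 2 ^ m := by
  have h₁ := card_ker_mul_two_pow_rank M
  rw [hM, Fintype.card_fin] at h₁
  have h₂ : ∑ h, kernelWeight M h =
      2 * 2 ^ m + (Finset.univ.filter fun x => M.mulVec x = 0).card := by
    have : ∀ h, kernelWeight M h = 2 + if M.mulVec h = 0 then 1 else 0 := by
      intro h; unfold kernelWeight; split_ifs <;> rfl
    simp only [this, Finset.sum_add_distrib, Finset.sum_const, Finset.card_univ,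
      Fintype.card_fun, ZMod.card, Fintype.card_fin, Finset.card_filter, smul_eq_mul]
    ring
  rw [h₂]
  omega

theorem le_prod_kernelWeight {m n : ℕ} {M : Matrix (Fin 2) (Fin m) (ZMod 2)}
    {p : Fin n → Fin m → ZMod 2} {I : Finset (Fin n)} (hp : ∀ j ∈ I, M.mulVec (p j) = 0) {k : ℕ}
    (hk : k ≤ I.card) : 3 ^ k * 2 ^ (n - k) ≤ ∏ j, kernelWeight M (p j) := by
  obtain ⟨J, hJI, rfl⟩ := Finset.exists_subset_card_eq hk
  calc 3 ^ J.card * 2 ^ (n - J.card) = ∏ j, if j ∈ J then 3 else 2 := by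
        rw [Finset.prod_ite]
        simp [Finset.filter_not, Finset.card_sdiff_of_subset]
    _ ≤ _ := by
        refine Finset.prod_le_prod' fun j _ => ?_
        unfold kernelWeight
        split_ifs with h₁ h₂ h₂
        · exact le_rfl
        · exact absurd (hp j (hJI h₁)) h₂
        · norm_num
        · exact le_rfl

/-- The rate 1/100 enters through 64 · 729^100 < 768^100. -/
theorem sixtyFour_pow_mul_lt {m n : ℕ} (hn : 0 < n) (hmn : 100 * m ≤ n) :
    64 ^ m * 729 ^ n < 768 ^ n := by
  obtain ⟨d, rfl⟩ := Nat.exists_eq_add_of_le hmn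
  rw [pow_add, pow_add, pow_mul, pow_mul, ← mul_assoc, ← mul_pow]
  rcases Nat.eq_zero_or_pos m with rfl | hm
  · simpa using Nat.pow_lt_pow_left (by norm_num : 729 < 768) (by omega : d ≠ 0)
  · exact Nat.mul_lt_mul_of_lt_of_le (Nat.pow_lt_pow_left (by norm_num) hm.ne')
      (Nat.pow_le_pow_left (by norm_num) d) (by positivity)

/-- The mean weight of a column is 9/4. If every matrix were bad, summing the product weights over
all matrices and the at most 4^m annihilators would give 3^(n/3) 2^(2n/3) ≤ 4^m (9/4)^n, which is
false. -/
theorem exists_isGood {m n : ℕ} (hn : 0 < n) (hmn : 100 * m ≤ n) :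
    ∃ H : Matrix (Fin m) (Fin n) (ZMod 2), IsGood (m - 1) H := by
  classical
  by_contra! hbad
  set k := (n + 2) / 3 with hk
  set Q := (Finset.univ : Finset (Matrix (Fin 2) (Fin m) (ZMod 2))).filter fun M => M.rank = 2
    with hQ
  have h₁ : ∀ p : Fin n → Fin m → ZMod 2,
      3 ^ k * 2 ^ (n - k) ≤ ∑ M ∈ Q, ∏ j, kernelWeight M (p j) := by
    intro p
    have := hbad (Matrix.of fun i j => p j i)
    unfold IsGood at this
    push Not at this
    obtain ⟨I, hI, hrank⟩ := this
    obtain ⟨M, hM, hMA⟩ := exists_left_annihilator _ hrank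
    refine (le_prod_kernelWeight (I := I) (fun j hj => ?_) (by omega)).trans
      (Finset.single_le_sum (f := fun M => ∏ j, kernelWeight M (p j)) (fun _ _ => Nat.zero_le _)
        (Finset.mem_filter.mpr ⟨Finset.mem_univ M, hM⟩))
    funext i
    exact congrFun (congrFun hMA i) ⟨j, hj⟩
  have h₂ : 4 ^ n * (3 ^ k * 2 ^ (n - k)) ≤ 4 ^ m * 9 ^ n := by
    have h := Finset.sum_le_sum fun p (_ : p ∈ Finset.univ) => h₁ p
    rw [Finset.sum_comm, Finset.sum_const, Finset.card_univ] at h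
    simp only [Fintype.card_fun, ZMod.card, Fintype.card_fin, smul_eq_mul,
      ← Fintype.sum_pow] at h
    have hpos : 0 < (2 ^ m) ^ n := by positivity
    refine Nat.le_of_mul_le_mul_left ?_ hpos
    calc (2 ^ m) ^ n * (4 ^ n * (3 ^ k * 2 ^ (n - k)))
        = 4 ^ n * ((2 ^ m) ^ n * (3 ^ k * 2 ^ (n - k))) := by ring
      _ ≤ 4 ^ n * ∑ M ∈ Q, (∑ h, kernelWeight M h) ^ n := Nat.mul_le_mul_left _ h
      _ = ∑ M ∈ Q, (9 * 2 ^ m) ^ n := by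
          rw [Finset.mul_sum]
          refine Finset.sum_congr rfl fun M hM => ?_
          rw [← mul_pow, four_mul_sum_kernelWeight (by simpa [hQ] using hM)]
      _ = Q.card * (9 * 2 ^ m) ^ n := by rw [Finset.sum_const, smul_eq_mul]
      _ ≤ 4 ^ m * (9 * 2 ^ m) ^ n := by
          refine Nat.mul_le_mul_right _ ((Finset.card_le_univ _).trans_eq ?_)
          rw [← Nat.card_eq_fintype_card]
          simp [Matrix, ← pow_mul, mul_comm m 2]
          rw [pow_mul]; norm_num
      _ = _ := by rw [mul_pow]; ring
  -- Cubing clears the exponent n/3, with 12 = 3 · 2²; rounding `k` up only replaces factors 2 by 3.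
  have h₃ : 12 ^ n ≤ (3 ^ k * 2 ^ (n - k)) ^ 3 := by
    obtain ⟨d, hd⟩ := Nat.exists_eq_add_of_le (show n ≤ k * 3 by omega)
    have hd' : 2 * n = (n - k) * 3 + d := by omega
    calc 12 ^ n = 3 ^ n * 2 ^ (2 * n) := by rw [pow_mul, ← mul_pow]; norm_num
      _ = 3 ^ n * 2 ^ d * (2 ^ (n - k)) ^ 3 := by rw [hd', pow_add, pow_mul]; ring
      _ ≤ 3 ^ n * 3 ^ d * (2 ^ (n - k)) ^ 3 := by gcongr; norm_num
      _ = _ := by rw [mul_pow, ← pow_mul 3, hd, pow_add]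
  have h₄ : 768 ^ n ≤ 64 ^ m * 729 ^ n := by
    calc 768 ^ n = 64 ^ n * 12 ^ n := by rw [← mul_pow]; norm_num
      _ ≤ 64 ^ n * (3 ^ k * 2 ^ (n - k)) ^ 3 := Nat.mul_le_mul_left _ h₃
      _ = (4 ^ n * (3 ^ k * 2 ^ (n - k))) ^ 3 := by
          rw [mul_pow (4 ^ n), ← pow_mul, mul_comm n 3, pow_mul]; norm_num
      _ ≤ (4 ^ m * 9 ^ n) ^ 3 := Nat.pow_le_pow_left h₂ 3
      _ = _ := by
          rw [mul_pow, ← pow_mul, ← pow_mul, mul_comm n 3, mul_comm m 3, pow_mul, pow_mul]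
          norm_num
  exact absurd (sixtyFour_pow_mul_lt hn hmn) (not_lt.mpr h₄)

/-! ### From counting to approximation and circuit size. -/

theorem prob_unif {n : ℕ} (p : Assignment n → Prop) [DecidablePred p] :
    prob (unif n) {x | p x} = ((Finset.univ.filter p).card : ℝ) / 2 ^ n := by
  rw [prob, unif, PMF.toOuterMeasure_uniformOfFintype_apply]
  simp [Fintype.card_subtype]

theorem IsGood.le_rank {m n s : ℕ} {H : Matrix (Fin m) (Fin n) (ZMod 2)} (hH : IsGood s H) :
    s ≤ H.rank := by
  refine (hH Finset.univ (by rw [Finset.card_univ, Fintype.card_fin]; omega)).trans_eq ?_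
  exact Matrix.rank_submatrix H (Equiv.refl _) (Equiv.subtypeUnivEquiv Finset.mem_univ)

theorem codeFun_eq_one_iff {m n : ℕ} (H : Matrix (Fin m) (Fin n) (ZMod 2)) (x : Assignment n) :
    codeFun H x = 1 ↔ H.mulVec x = 0 := by
  unfold codeFun; split_ifs with h <;> simp [h]

theorem codeFun_ne_zero_iff {m n : ℕ} (H : Matrix (Fin m) (Fin n) (ZMod 2)) (x : Assignment n) :
    codeFun H x ≠ 0 ↔ H.mulVec x = 0 := by
  unfold codeFun; split_ifs with h <;> simp [h]

theorem isTriviallyWeaklyApproximable_codeFun {m n s : ℕ} {H : Matrix (Fin m) (Fin n) (ZMod 2)}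
    (hH : IsGood s H) {ε : ℝ} (hε : 1 ≤ ε * 2 ^ s) :
    IsTriviallyWeaklyApproximable (unif n) ε (codeFun H) := by
  have h₁ := card_ker_mul_two_pow_rank H
  rw [Fintype.card_fin] at h₁
  have h₂ : (Finset.univ.filter fun x => H.mulVec x = 0).card * 2 ^ s ≤ 2 ^ n :=
    (Nat.mul_le_mul_left _ (Nat.pow_le_pow_right two_pos hH.le_rank)).trans_eq h₁
  have h₃ : ((Finset.univ.filter fun x => H.mulVec x = 0).card : ℝ) * 2 ^ s ≤ 2 ^ n := by
    exact_mod_cast h₂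
  unfold IsTriviallyWeaklyApproximable IsWeakApprox
  simp only [codeFun_ne_zero_iff]
  rw [prob_unif, div_le_iff₀ (by positivity)]
  have hs : (0 : ℝ) < 2 ^ s := by positivity
  have hε0 : 0 < ε := pos_of_mul_pos_left (zero_lt_one.trans_le hε) hs.le
  calc ((Finset.univ.filter fun x => H.mulVec x = 0).card : ℝ)
      ≤ (Finset.univ.filter fun x => H.mulVec x = 0).card * (ε * 2 ^ s) :=
        le_mul_of_one_le_right (by positivity) hε
    _ = ε * ((Finset.univ.filter fun x => H.mulVec x = 0).card * 2 ^ s) := by ring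
    _ ≤ _ := mul_le_mul_of_nonneg_left h₃ hε0.le

/-- Cauchy–Schwarz over the rectangles of the d-DNNF. -/
theorem NNF.sq_card_common_models_le {m n s : ℕ} {H : Matrix (Fin m) (Fin n) (ZMod 2)}
    (hH : IsGood s H) (hn : 2 ≤ n) {C : NNF n} (hC : C.IsDDNNF) :
    (∑ x, if H.mulVec x = 0 then (C.eval x).val else 0) ^ 2 * (2 ^ s) ^ 2 ≤
      C.size ^ 2 * (2 ^ n * ∑ x, (C.eval x).val) := by
  obtain ⟨X, a, b, hX, ha, hb, hab⟩ := NNF.exists_balanced_rectangles hn hC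
  have hle : ∀ i x, a i x * b i x ≤ 1 := by
    intro i x
    refine (Finset.single_le_sum (f := fun i => a i x * b i x) (fun _ _ => Nat.zero_le _)
      (Finset.mem_univ i)).trans ?_
    rw [hab]
    exact Nat.lt_succ_iff.mp (ZMod.val_lt (C.eval x))
  have h₁ : (∑ x, if H.mulVec x = 0 then (C.eval x).val else 0) =
      ∑ i, ∑ x, if H.mulVec x = 0 then a i x * b i x else 0 := by
    rw [Finset.sum_comm]
    refine Finset.sum_congr rfl fun x _ => ?_
    rw [← hab]
    split_ifs <;> simp
  have h₂ : ∑ x, (C.eval x).val = ∑ i, ∑ x, a i x * b i x := by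
    rw [Finset.sum_comm]
    exact Finset.sum_congr rfl fun x _ => (hab x).symm
  rw [h₁, h₂]
  calc _ ≤ (C.size ^ 2 * ∑ i, (∑ x, if H.mulVec x = 0 then a i x * b i x else 0) ^ 2) *
        (2 ^ s) ^ 2 := by
        refine Nat.mul_le_mul_right _ (sq_sum_le_card_mul_sum_sq.trans_eq ?_)
        rw [Finset.card_univ, Fintype.card_prod, Fintype.card_fin, sq C.size]
        rfl
    _ = C.size ^ 2 * ∑ i, (∑ x, if H.mulVec x = 0 then a i x * b i x else 0) ^ 2 *
        (2 ^ s) ^ 2 := by rw [mul_assoc, Finset.sum_mul]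
    _ ≤ C.size ^ 2 * ∑ i, 2 ^ n * ∑ x, a i x * b i x :=
        Nat.mul_le_mul_left _ (Finset.sum_le_sum fun i _ =>
          sq_sum_codewords_le H hH (hX i) (ha i) (hb i) (hle i))
    _ = _ := by rw [← Finset.mul_sum]

theorem NNF.le_sq_size_of_isStrongApprox {m n : ℕ} {H : Matrix (Fin m) (Fin n) (ZMod 2)}
    (hH : IsGood (m - 1) H) (hm : 1 ≤ m) (hn : 2 ≤ n) {C : NNF n} (hC : C.IsDDNNF) {ε : ℝ}
    (hε1 : ε < 1) (happrox : IsStrongApprox (unif n) ε (codeFun H) C.eval) :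
    (1 - ε) ^ 2 * 2 ^ m ≤ 8 * (C.size : ℝ) ^ 2 := by
  classical
  set F := (Finset.univ.filter fun x => H.mulVec x = 0).card with hF
  set D := (Finset.univ.filter fun x => codeFun H x ≠ C.eval x).card with hD
  set P := ∑ x, if H.mulVec x = 0 then (C.eval x).val else 0 with hP
  set T := ∑ x, (C.eval x).val with hT
  have hDF : (D : ℝ) ≤ ε * F := by
    unfold IsStrongApprox at happrox
    simp only [codeFun_eq_one_iff] at happrox
    rw [prob_unif, prob_unif, ← mul_div_assoc,
      div_le_div_iff_of_pos_right (by positivity)] at happrox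
    exact happrox
  have hzmod : ∀ z : ZMod 2, z = 0 ∨ z = 1 := by decide
  have hval : (1 : ZMod 2).val = 1 := rfl
  have hFP : F ≤ P + D := by
    rw [hF, hP, hD, Finset.card_filter, Finset.card_filter, ← Finset.sum_add_distrib]
    refine Finset.sum_le_sum fun x _ => ?_
    unfold codeFun
    rcases hzmod (C.eval x) with h | h <;> by_cases h' : H.mulVec x = 0 <;> simp [h, h', hval]
  have hTF : T ≤ F + D := by
    rw [hF, hT, hD, Finset.card_filter, Finset.card_filter, ← Finset.sum_add_distrib]
    refine Finset.sum_le_sum fun x _ => ?_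
    unfold codeFun
    rcases hzmod (C.eval x) with h | h <;> by_cases h' : H.mulVec x = 0 <;> simp [h, h', hval]
  have hFm : 2 ^ n ≤ F * 2 ^ m := by
    have h := card_ker_mul_two_pow_rank H
    rw [Fintype.card_fin] at h
    rw [← h]
    exact Nat.mul_le_mul_left _ (Nat.pow_le_pow_right two_pos
      ((Matrix.rank_le_card_height H).trans_eq (Fintype.card_fin m)))
  have hCS := NNF.sq_card_common_models_le hH hn hC
  rw [← hP, ← hT] at hCS
  obtain ⟨s, rfl⟩ := Nat.exists_eq_add_of_le' hm
  rw [Nat.add_sub_cancel] at hCS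
  have hFP' : (F : ℝ) ≤ P + D := by exact_mod_cast hFP
  have hTF' : (T : ℝ) ≤ F + D := by exact_mod_cast hTF
  have hFm' : (2 : ℝ) ^ n ≤ F * 2 ^ (s + 1) := by exact_mod_cast hFm
  have hCS' : (P : ℝ) ^ 2 * (2 ^ s) ^ 2 ≤ (C.size : ℝ) ^ 2 * (2 ^ n * T) := by
    exact_mod_cast hCS
  have hn0 : (0 : ℝ) < 2 ^ n := by positivity
  have hs0 : (0 : ℝ) < 2 ^ s := by positivity
  have hF0 : (0 : ℝ) < F := pos_of_mul_pos_left (hn0.trans_le hFm') (by positivity)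
  have hP1 : (1 - ε) * F ≤ P := by linarith
  have hT1 : (T : ℝ) ≤ 2 * F := by nlinarith
  have h₁ : ((1 - ε) * F) ^ 2 ≤ (P : ℝ) ^ 2 :=
    pow_le_pow_left₀ (mul_nonneg (by linarith) hF0.le) hP1 2
  have h₂ : (F * 2 ^ n * 2 ^ s) * ((1 - ε) ^ 2 * 2 ^ (s + 1)) ≤
      (F * 2 ^ n * 2 ^ s) * (8 * (C.size : ℝ) ^ 2) := by
    calc (F * 2 ^ n * 2 ^ s) * ((1 - ε) ^ 2 * 2 ^ (s + 1))
        ≤ (F * (F * 2 ^ (s + 1)) * 2 ^ s) * ((1 - ε) ^ 2 * 2 ^ (s + 1)) := by gcongr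
      _ = 4 * 2 ^ s * (((1 - ε) * F) ^ 2 * (2 ^ s) ^ 2) := by ring
      _ ≤ 4 * 2 ^ s * ((P : ℝ) ^ 2 * (2 ^ s) ^ 2) := by gcongr
      _ ≤ 4 * 2 ^ s * ((C.size : ℝ) ^ 2 * (2 ^ n * T)) := by gcongr
      _ ≤ 4 * 2 ^ s * ((C.size : ℝ) ^ 2 * (2 ^ n * (2 * F))) := by gcongr
      _ = _ := by ring
  exact le_of_mul_le_mul_left h₂ (by positivity)

theorem theorem4 (ε : ℝ) (hε0 : 0 ≤ ε) (hε1 : ε < 1) :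
    ∃ c : ℝ, 0 < c ∧ ∃ n₀ : ℕ, ∀ n : ℕ, n₀ ≤ n →
      (goodCodeClass n).Nonempty ∧
      ∀ f ∈ goodCodeClass n,
        (0 < ε → IsTriviallyWeaklyApproximable (unif n) ε f) ∧
        ∀ C : NNF n, C.IsDDNNF → IsStrongApprox (unif n) ε f C.eval →
          (2 : ℝ) ^ (c * (n : ℝ)) ≤ (C.size : ℝ) := by
  obtain ⟨k, hk⟩ := pow_unbounded_of_one_lt (16 / (1 - ε) ^ 2) (one_lt_two (α := ℝ))
  -- For ε = 0 the quotient is 0, and `l` serves only the case ε > 0.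
  obtain ⟨l, hl⟩ := pow_unbounded_of_one_lt (1 / ε) (one_lt_two (α := ℝ))
  -- The size is at least a constant times 2^(n/200); half of the exponent absorbs the constant. The
  -- term 200k does this, and 100(l + 1) ensures m - 1 ≥ l.
  refine ⟨1 / 400, by norm_num, 200 * k + 100 * (l + 1), fun n hn => ⟨?_, ?_⟩⟩
  · obtain ⟨H, hH⟩ := exists_isGood (m := n / 100) (n := n) (by omega) (by omega)
    exact ⟨_, H, hH, rfl⟩
  rintro _ ⟨H, hH, rfl⟩
  refine ⟨fun hε => isTriviallyWeaklyApproximable_codeFun hH ?_, fun C hC happrox => ?_⟩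
  · rw [div_lt_iff₀' hε] at hl
    exact hl.le.trans (mul_le_mul_of_nonneg_left
      (pow_le_pow_right₀ one_le_two (by omega)) hε.le)
  have hN := NNF.le_sq_size_of_isStrongApprox hH (by omega) (by omega) hC hε1 happrox
  have hδ : 0 < (1 - ε) ^ 2 := pow_pos (by linarith) 2
  rw [div_lt_iff₀' hδ] at hk
  have hm : (n : ℝ) / 100 - 1 ≤ ((n / 100 : ℕ) : ℝ) := by
    have : n ≤ 100 * (n / 100) + 100 := by omega
    have : (n : ℝ) ≤ 100 * ((n / 100 : ℕ) : ℝ) + 100 := by exact_mod_cast this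
    linarith
  have hk' : (2 : ℝ) ^ k ≤ 2 ^ ((n : ℝ) / 200) := by
    rw [← Real.rpow_natCast]
    refine Real.rpow_le_rpow_of_exponent_le one_le_two ?_
    have : (200 * k : ℝ) ≤ n := by exact_mod_cast (by omega : 200 * k ≤ n)
    linarith
  have hm' : (2 : ℝ) ^ ((n : ℝ) / 200) * 2 ^ ((n : ℝ) / 200) ≤ 2 * 2 ^ (n / 100) := by
    rw [← Real.rpow_natCast, ← Real.rpow_add two_pos]
    rw [← Real.rpow_one_add' zero_le_two (by positivity)]
    exact Real.rpow_le_rpow_of_exponent_le one_le_two (by linarith)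
  have hsq : ((2 : ℝ) ^ (1 / 400 * (n : ℝ))) ^ 2 = 2 ^ ((n : ℝ) / 200) := by
    rw [← Real.rpow_natCast, ← Real.rpow_mul zero_le_two]
    congr 1
    push_cast
    ring
  refine le_of_sq_le_sq ?_ (Nat.cast_nonneg _)
  rw [hsq]
  set y : ℝ := 2 ^ ((n : ℝ) / 200)
  have hy : 0 < y := Real.rpow_pos_of_pos two_pos _
  -- Here 16 = 8 · 2: the 8 comes from the size bound, the 2 from rounding n/100 down.
  have h₁ : 16 ≤ (1 - ε) ^ 2 * y := hk.le.trans (mul_le_mul_of_nonneg_left hk' hδ.le)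
  have h₂ : 16 * y ≤ (1 - ε) ^ 2 * y * y := mul_le_mul_of_nonneg_right h₁ hy.le
  have h₃ : (1 - ε) ^ 2 * (y * y) ≤ (1 - ε) ^ 2 * (2 * 2 ^ (n / 100)) :=
    mul_le_mul_of_nonneg_left hm' hδ.le
  linarith
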